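/- Let $B_1,\dots,B_m$ ($m\ge 1$) be independent rate two Brownian motions on $[0,\infty)$ started from the origin, i.e. $B_i/\sqrt2$ is a standard Brownian motion, with continuous paths. For $0\le x<y$ and $1\le k\le \ell\le m$, a path from $(x,\ell)$ to $(y,k)$ is a non-increasing function $\pi:[x,y]\to\{1,\dots,m\}$, càdlàg on $(x,y)$, with $\pi(x)=\ell$ and $\pi(y)=k$. Let $t_i(\pi)$, $k\le i<\ell$, be the time at which $\pi$ jumps to a level $\le i$ (the infimum of $\{s\in[x,y]:\pi(s)\le i\}$), and put $t_\ell=x$, $t_{k-1}=y$. The length of $\pi$ is $\sum_{i=k}^{\ell}\big(B_i(t_{i-1})-B_i(t_i)\big)$, and the last passage value $B[(x,\ell)\to(y,k)]$ is the supremum of the lengths of all such paths; for $x=y$ it is $0$. Let $g_1\ge g_2\ge\dots\ge g_m$ be real numbers. Brownian TASEP with initial data $\underline g$ is the process $$H_k(y)=\max_{k\le \ell\le m}\big(g_\ell+B[(0,\ell)\to(y,k)]\big),\qquad y\in[0,\infty),\ 1\le k\le m.$$ Proposition. The process $H=(H_1,\dots,H_m)$ has continuous paths, its restrictions to compact intervals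 $[x,y]$ are random elements of $C([x,y],\mathbb R)^m$ (with the Borel $\sigma$-algebra of the product of the uniform topologies), and for all $0\le x\le y$ and all Borel sets $A\subseteq C([x,y],\mathbb R)^m$, almost surely $$\mathbb P\big[H|_{[x,y]}\in A\,\big|\,\sigma(H|_{[0,x]})\big]=\mathbb P\big[H|_{[x,y]}\in A\,\big|\,\sigma(H(x))\big].$$ In other words, $H$ is a continuous Markov process with respect to its own filtration: with $\mathcal F_s=\sigma(H(u):u\le s)$, for all $0\le s\le t$ and all Borel $A\subseteq\mathbb R^m$, almost surely $\mathbb P[H(t)\in A\mid\mathcal F_s]=\mathbb P[H(t)\in A\mid\sigma(H(s))]$. -/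

import Mathlib

open MeasureTheory ProbabilityTheory Set Filter
open scoped NNReal Topology

noncomputable section

/-! ### Last passage percolation

The lines of an ensemble `f : Fin m → ℝ≥0 → ℝ` are indexed by `Fin m` (that is, `0, …, m - 1`
instead of `1, …, m`), and time runs over `[0, ∞)`. -/

/-- `π` is a path from `(x, ℓ)` to `(y, k)`: on `[x, y]` it is non-increasing, it is càdlàg on
`(x, y)`, and it starts at level `ℓ` and ends at level `k`. Only the values of `π` on `[x, y]`
matter. -/
structure IsLPPPath {m : ℕ} (x y : ℝ≥0) (ℓ k : Fin m) (π : ℝ≥0 → Fin m) : Prop where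
  antitone : AntitoneOn π (Icc x y)
  rightCts : ∀ s ∈ Ioo x y, ContinuousWithinAt π (Ici s) s
  leftLim : ∀ s ∈ Ioo x y, ∃ a : Fin m, Tendsto π (𝓝[<] s) (𝓝 a)
  start : π x = ℓ
  finish : π y = k

/-- The time in `[x, y]` at which the path `π` jumps to line `i` or below. For the starting
line of the path this is `x`. -/
def enterTime {m : ℕ} (x y : ℝ≥0) (π : ℝ≥0 → Fin m) (i : Fin m) : ℝ≥0 :=
  sInf (insert y {s | s ∈ Icc x y ∧ π s ≤ i})

/-- The time in `[x, y]` at which the path `π` jumps strictly below line `i`. For the final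
line of the path this is `y`; for the others it is the time of entering the next lower line. -/
def leaveTime {m : ℕ} (x y : ℝ≥0) (π : ℝ≥0 → Fin m) (i : Fin m) : ℝ≥0 :=
  sInf (insert y {s | s ∈ Icc x y ∧ π s < i})

/-- The length of a path from `(x, ℓ)` to `(y, k)`: the sum over the lines `k ≤ i ≤ ℓ` of the
increment of `f i` between the times at which the path enters and leaves line `i`. -/
def pathLength {m : ℕ} (f : Fin m → ℝ≥0 → ℝ) (x y : ℝ≥0) (ℓ k : Fin m) (π : ℝ≥0 → Fin m) : ℝ :=
  ∑ i ∈ Finset.Icc k ℓ, (f i (leaveTime x y π i) - f i (enterTime x y π i))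

/-- The last passage value `f[(x, ℓ) → (y, k)]`, the supremum of the lengths of all paths from
`(x, ℓ)` to `(y, k)`. For `x = y` it is `0`, the length of the degenerate path that runs through
the lines `ℓ, …, k` instantaneously. -/
def lastPassage {m : ℕ} (f : Fin m → ℝ≥0 → ℝ) (x y : ℝ≥0) (ℓ k : Fin m) : ℝ :=
  if x < y then sSup {L | ∃ π, IsLPPPath x y ℓ k π ∧ L = pathLength f x y ℓ k π} else 0

/-! ### Brownian TASEP -/

/-- `B` is an ensemble of `m` independent rate two Brownian motions started from the origin,
a random element of the space of `m`-tuples of continuous paths on `[0, ∞)`. -/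
structure IsRateTwoBrownianEnsemble {m : ℕ} {Ω : Type*} {mΩ : MeasurableSpace Ω}
    (B : Fin m → ℝ≥0 → Ω → ℝ) (P : Measure Ω) : Prop where
  measurable : ∀ i t, Measurable (B i t)
  continuous : ∀ i ω, Continuous fun t => B i t ω
  brownian : ∀ i, IsBrownianReal (fun t ω => B i t ω / √2) P
  indep : iIndepFun (fun i ω t => B i t ω) P

/-- Brownian TASEP driven by `B` with initial data `g`: the process whose `k`-th coordinate at
time `y` is `max_{ℓ ≥ k} (g ℓ + B[(0, ℓ) → (y, k)])`. -/
def brownianTASEP {m : ℕ} {Ω : Type*} (g : Fin m → ℝ) (B : Fin m → ℝ≥0 → Ω → ℝ) :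
    ℝ≥0 → Ω → Fin m → ℝ := fun y ω k =>
  (Finset.Ici k).sup' ⟨k, Finset.mem_Ici.2 le_rfl⟩ fun ℓ =>
    g ℓ + lastPassage (fun i t => B i t ω) 0 y ℓ k

/-! ### Path restrictions and the Markov property -/

/-- The space of `m`-tuples of continuous paths on `[x, y]`, with the product of the uniform
topologies. -/
abbrev PathSpace (m : ℕ) (x y : ℝ≥0) : Type := Fin m → C(Icc x y, ℝ)

/-- The restriction to `[x, y]` of a process with continuous paths, as a random element of the
path space. -/
def restrictPath {m : ℕ} {Ω : Type*} (X : ℝ≥0 → Ω → Fin m → ℝ)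
    (hX : ∀ ω, Continuous fun t => X t ω) (x y : ℝ≥0) : Ω → PathSpace m x y := fun ω k =>
  ⟨fun t => X t ω k, ((continuous_apply k).comp (hX ω)).comp continuous_subtype_val⟩

/-- The Markov property of a process `X` with respect to a filtration `𝓕`: `X` is adapted, and
the conditional law of `X t` given `𝓕 s` is its conditional law given `X s`, for `s ≤ t`. -/
structure IsMarkovProcess {Ω E : Type*} {mΩ : MeasurableSpace Ω} [MeasurableSpace E]
    (𝓕 : Filtration ℝ≥0 mΩ) (X : ℝ≥0 → Ω → E) (P : Measure Ω) : Prop where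
  adapted : Adapted 𝓕 X
  markov : ∀ s t, s ≤ t → ∀ A : Set E, MeasurableSet A →
    P⟦X t ⁻¹' A | 𝓕 s⟧ =ᵐ[P] P⟦X t ⁻¹' A | MeasurableSpace.comap (X s) inferInstance⟧

end

/-! A path to `(y, k)` either stays on line `k` throughout or enters it from line `k + 1` at some
time `s`. Hence `H_k(y)` is the larger of `g_k + B_k(y) - B_k(0)` and the supremum over `s ≤ y` of
`H_{k+1}(s) + B_k(y) - B_k(s)`. Splitting that supremum at time `x` gives a flow (`isLUB_pushSet`):
pushes before `x` are already recorded in `H_k(x)`, so after `x` the heights depend only on `H(x)`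
and on the increments of `B` after `x`. Induction from the top line down turns this into continuity
and measurability (`measurable_brownianTASEP_apply`).

The increments after `x` are independent of `B` on `[0, x]`, hence of the past of `H`
(`indepFun_past_future`). What remains is abstract (`condExp_eq_of_indep_sup`): if `𝓗 ≤ 𝓖` and `𝓕`
is independent of `𝓖`, conditioning an event of `𝓗 ⊔ 𝓕` on `𝓖` is the same as conditioning it on
`𝓗`. Both forms of the Markov property are instances with `𝓗 = σ(H(x))`. -/

/-! ### Last passage values in terms of jump times -/

/-- `T` lists the jump times of a path from `(x, ℓ)` to `(y, k)`: the path runs along line `i`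
during `[T (i + 1), T i]`. -/
structure IsJumpTimes {m : ℕ} (x y : ℝ≥0) (ℓ k : Fin m) (T : ℕ → ℝ≥0) : Prop where
  antitone : Antitone T
  start : T (ℓ + 1) = x
  finish : T k = y

/-- The length of the path with jump times `T`. -/
noncomputable def jumpLength {m : ℕ} (f : Fin m → ℝ≥0 → ℝ) (ℓ k : Fin m) (T : ℕ → ℝ≥0) : ℝ :=
  ∑ i ∈ Finset.Icc k ℓ, (f i (T i) - f i (T (i + 1)))

section JumpTimes

variable {m : ℕ} {x y : ℝ≥0} {ℓ k : Fin m} {π : ℝ≥0 → Fin m} {f : Fin m → ℝ≥0 → ℝ}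

theorem le_leaveTime (hxy : x ≤ y) (i : Fin m) : x ≤ leaveTime x y π i := by
  refine le_csInf ⟨y, mem_insert _ _⟩ ?_
  rintro s (rfl | hs)
  exacts [hxy, hs.1.1]

theorem leaveTime_anti : Antitone (leaveTime (m := m) x y π) := by
  intro i j hij
  refine csInf_le_csInf (OrderBot.bddBelow _) ⟨y, mem_insert _ _⟩ (insert_subset_insert ?_)
  exact fun s hs => ⟨hs.1, hs.2.trans_le hij⟩

theorem enterTime_eq_leaveTime {i j : Fin m} (hij : (j : ℕ) = i + 1) :
    enterTime x y π i = leaveTime x y π j := by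
  have : ∀ s, π s ≤ i ↔ π s < j := fun s => by
    rw [Fin.le_def, Fin.lt_def, hij, Nat.lt_succ_iff]
  simp only [enterTime, leaveTime, this]

namespace IsLPPPath

theorem enterTime_start (hxy : x ≤ y) (hπ : IsLPPPath x y ℓ k π) : enterTime x y π ℓ = x := by
  refine le_antisymm (csInf_le (OrderBot.bddBelow _)
    (mem_insert_of_mem _ ⟨left_mem_Icc.2 hxy, hπ.start.le⟩)) (le_csInf ⟨y, mem_insert _ _⟩ ?_)
  rintro s (rfl | hs)
  exacts [hxy, hs.1.1]

theorem leaveTime_finish (hπ : IsLPPPath x y ℓ k π) : leaveTime x y π k = y := by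
  have : {s | s ∈ Icc x y ∧ π s < k} = ∅ := by
    refine eq_empty_of_forall_notMem fun s hs => hs.2.not_ge ?_
    rw [← hπ.finish]
    exact hπ.antitone hs.1 (right_mem_Icc.2 (hs.1.1.trans hs.1.2)) hs.1.2
  rw [leaveTime, this, insert_empty_eq, csInf_singleton]

theorem exists_jumpTimes (hxy : x ≤ y) (hπ : IsLPPPath x y ℓ k π) :
    ∃ T, IsJumpTimes x y ℓ k T ∧ pathLength f x y ℓ k π = jumpLength f ℓ k T := by
  have hkℓ : k ≤ ℓ := by
    rw [← hπ.start, ← hπ.finish]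
    exact hπ.antitone (left_mem_Icc.2 hxy) (right_mem_Icc.2 hxy) hxy
  set T : ℕ → ℝ≥0 := fun n => if h : n ≤ ℓ then leaveTime x y π ⟨n, h.trans_lt ℓ.2⟩ else x with hT
  have hTi : ∀ i : Fin m, i ≤ ℓ → T i = leaveTime x y π i := fun i hi => by
    simp [hT, Fin.le_def.1 hi]
  have hstart : T (ℓ + 1) = x := by simp [hT]
  refine ⟨T, ⟨fun a b hab => ?_, hstart, ?_⟩, Finset.sum_congr rfl fun i hi => ?_⟩
  · by_cases hb : b ≤ ℓ
    · simp only [hT, hb, hab.trans hb, dif_pos]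
      exact leaveTime_anti (Fin.mk_le_mk.2 hab)
    · by_cases ha : a ≤ ℓ
      · simpa only [hT, hb, ha, dif_pos, dif_neg, not_false_eq_true] using le_leaveTime hxy _
      · simp [hT, ha, hb]
  · rw [hTi k hkℓ, hπ.leaveTime_finish]
  · rw [Finset.mem_Icc] at hi
    rw [hTi i hi.2]
    rcases hi.2.eq_or_lt with rfl | hlt
    · rw [hstart, hπ.enterTime_start hxy]
    · have hm : (i : ℕ) + 1 < m := lt_of_le_of_lt (Fin.lt_def.1 hlt) ℓ.2
      have := hTi ⟨i + 1, hm⟩ (Fin.le_def.2 (Fin.lt_def.1 hlt))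
      rw [enterTime_eq_leaveTime (j := ⟨i + 1, hm⟩) rfl, ← this]

end IsLPPPath

/-- The infimum sees only the interior behaviour. At `x` one implication suffices, which leaves room
for a path whose value at `x` is prescribed; at `y` nothing is needed, since `y` is inserted anyway.
-/
theorem sInf_insert_Icc_eq {p : ℝ≥0 → Prop} {a : ℝ≥0} (hxa : x ≤ a) (hay : a ≤ y)
    (hx : p x → a ≤ x) (h : ∀ u ∈ Ioo x y, p u ↔ a ≤ u) :
    sInf (insert y {s | s ∈ Icc x y ∧ p s}) = a := by
  refine IsGLB.csInf_eq ⟨?_, fun b hb => le_of_forall_gt_imp_ge_of_dense fun c hc => ?_⟩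
    ⟨y, mem_insert _ _⟩
  · rintro s (rfl | ⟨hs, hps⟩)
    · exact hay
    · rcases hs.1.eq_or_lt with rfl | hxs
      · exact hx hps
      · rcases hs.2.eq_or_lt with rfl | hsy
        · exact hay
        · exact (h s ⟨hxs, hsy⟩).1 hps
  · rcases le_or_gt y c with hyc | hcy
    · exact (hb (mem_insert _ _)).trans hyc
    · exact hb (mem_insert_of_mem _ ⟨⟨hxa.trans hc.le, hcy.le⟩,
        (h c ⟨hxa.trans_lt hc, hcy⟩).2 hc.le⟩)

namespace IsJumpTimes

variable {T : ℕ → ℝ≥0}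

/-- The level at time `u` is the least `i ≥ k` with `T (i + 1) ≤ u`; line `ℓ` qualifies because `T
(ℓ + 1) = x`. -/
theorem exists_level (hT : IsJumpTimes x y ℓ k T) (hkℓ : k ≤ ℓ) {u : ℝ≥0} (hu : x ≤ u) :
    ∃ j : Fin m, k ≤ j ∧ j ≤ ℓ ∧ ∀ i, k ≤ i → (j ≤ i ↔ T (i + 1) ≤ u) := by
  have hℓ : ℓ ∈ {i : Fin m | k ≤ i ∧ T (i + 1) ≤ u} := ⟨hkℓ, hT.start.trans_le hu⟩
  obtain ⟨j, hj, hmin⟩ := (Set.toFinite {i : Fin m | k ≤ i ∧ T (i + 1) ≤ u}).exists_minimal ⟨ℓ, hℓ⟩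
  have hle : ∀ i ∈ {i : Fin m | k ≤ i ∧ T (i + 1) ≤ u}, j ≤ i := fun i hi =>
    (le_total j i).elim id fun h => hmin hi h
  exact ⟨j, hj.1, hle ℓ hℓ, fun i hi => ⟨fun hji =>
    (hT.antitone (Nat.succ_le_succ (Fin.le_def.1 hji))).trans hj.2, fun h => hle i ⟨hi, h⟩⟩⟩

theorem exists_path (hT : IsJumpTimes x y ℓ k T) (hxy : x < y) (hkℓ : k ≤ ℓ) :
    ∃ π, IsLPPPath x y ℓ k π ∧ pathLength f x y ℓ k π = jumpLength f ℓ k T := by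
  have : Nonempty (Fin m) := ⟨k⟩
  choose! j hkj hjℓ hj using fun u (hu : x ≤ u) => hT.exists_level hkℓ hu
  -- Several jump times may equal `x`, and then `j x < ℓ`; the value at `x` is therefore set by
  -- hand. Right continuity is only required on the open interval.
  set π : ℝ≥0 → Fin m := fun u => if u = x then ℓ else j u with hπ
  have hπj : ∀ u, x < u → π u = j u := fun u hu => if_neg hu.ne'
  have hπx : π x = ℓ := if_pos rfl
  have hle : ∀ u v, x < u → x < v → (∀ i : Fin m, T (i + 1) ≤ u → T (i + 1) ≤ v) → π v ≤ π u := by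
    intro u v hu hv h
    rw [hπj u hu, hπj v hv, hj v hv.le _ (hkj u hu.le)]
    exact h _ ((hj u hu.le _ (hkj u hu.le)).1 le_rfl)
  have hanti : AntitoneOn π (Ici x) := by
    intro u hu v hv huv
    rcases (mem_Ici.1 hu).eq_or_lt with rfl | hxu
    · rw [hπx]
      rcases (mem_Ici.1 hv).eq_or_lt with rfl | hxv
      · exact hπx.le
      · exact (hπj v hxv).trans_le (hjℓ v hxv.le)
    · exact hle u v hxu (hxu.trans_le huv) fun i hi => hi.trans huv
  have hmem : ∀ i : Fin m, k ≤ i → i ≤ ℓ → (x ≤ T (i + 1) ∧ T (i + 1) ≤ T i) ∧ T i ≤ y := by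
    intro i hki hiℓ
    rw [← hT.start, ← hT.finish]
    exact ⟨⟨hT.antitone (Nat.succ_le_succ (Fin.le_def.1 hiℓ)), hT.antitone (Nat.le_succ _)⟩,
      hT.antitone (Fin.le_def.1 hki)⟩
  refine ⟨π, ⟨hanti.mono Icc_subset_Ici_self, fun s hs => ?_, fun s hs => ?_, hπx, ?_⟩,
    Finset.sum_congr rfl fun i hi => ?_⟩
  -- Just to the right of `s` none of the finitely many jump times is newly passed, so `π` is
  -- locally constant there.
  · have h : ∀ᶠ v in 𝓝[≥] s, ∀ i : Fin m, T (i + 1) ≤ v → T (i + 1) ≤ s := by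
      refine eventually_all.2 fun i => nhdsWithin_le_nhds ?_
      rcases le_or_gt (T (i + 1)) s with h | h
      · exact Eventually.of_forall fun _ _ => h
      · filter_upwards [gt_mem_nhds h] with v hv hv'
        exact absurd hv hv'.not_gt
    refine tendsto_const_nhds.congr' ?_
    filter_upwards [h, self_mem_nhdsWithin] with v hv hsv
    have hsv : s ≤ v := hsv
    exact le_antisymm (hle v s (hs.1.trans_le hsv) hs.1 hv) (hanti hs.1.le (hs.1.le.trans hsv) hsv)
  · have h : ∀ᶠ v in 𝓝[<] s, ∀ i : Fin m, T (i + 1) ≤ v ↔ T (i + 1) < s := by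
      refine eventually_all.2 fun i => ?_
      rcases lt_or_ge (T (i + 1)) s with h | h
      · filter_upwards [nhdsWithin_le_nhds (lt_mem_nhds h)] with v hv
        simp [h, hv.le]
      · filter_upwards [self_mem_nhdsWithin] with v hv
        simp [h.not_gt, (lt_of_lt_of_le hv h).not_ge]
    have h' := h.and (nhdsWithin_le_nhds (lt_mem_nhds hs.1))
    have : (𝓝[<] s).NeBot := nhdsLT_neBot_of_exists_lt ⟨x, hs.1⟩
    obtain ⟨v₀, hv₀, hxv₀⟩ := h'.exists
    refine ⟨π v₀, tendsto_const_nhds.congr' ?_⟩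
    filter_upwards [h'] with v ⟨hv, hxv⟩
    exact le_antisymm (hle v v₀ hxv hxv₀ fun i hi => (hv₀ i).2 ((hv i).1 hi))
      (hle v₀ v hxv₀ hxv fun i hi => (hv i).2 ((hv₀ i).1 hi))
  · rw [hπj y hxy]
    refine le_antisymm ((hj y hxy.le k le_rfl).2 ?_) (hkj y hxy.le)
    rw [← hT.finish]
    exact hT.antitone (Nat.le_succ _)
  · rw [Finset.mem_Icc] at hi
    obtain ⟨⟨h₁, h₂⟩, h₃⟩ := hmem i hi.1 hi.2
    have henter : enterTime x y π i = T (i + 1) := by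
      refine sInf_insert_Icc_eq h₁ (h₂.trans h₃) (fun h => ?_) fun u hu => ?_
      · rw [hπx] at h
        rw [le_antisymm hi.2 h, hT.start]
      · rw [hπj u hu.1, hj u hu.1.le i hi.1]
    have hleave : leaveTime x y π i = T i := by
      refine sInf_insert_Icc_eq (h₁.trans h₂) h₃ (fun h => ?_) fun u hu => ?_
      · rw [hπx] at h
        exact absurd h hi.2.not_gt
      · rw [hπj u hu.1]
        rcases hi.1.eq_or_lt with rfl | hki
        · rw [hT.finish]
          exact iff_of_false (hkj u hu.1.le).not_gt hu.2.not_ge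
        -- Being strictly below `i` means being at most at `i - 1`, whose threshold is `T i`.
        · have hi0 : (i : ℕ) - 1 + 1 = i := Nat.sub_add_cancel (Nat.one_le_of_lt (Fin.lt_def.1 hki))
          have hpred := hj u hu.1.le ⟨i - 1, (Nat.sub_le _ _).trans_lt i.2⟩
            (Fin.le_def.2 (Nat.le_sub_one_of_lt (Fin.lt_def.1 hki)))
          simp only [hi0] at hpred
          rw [← hpred, Fin.lt_def, Fin.le_def]
          simp only
          omega
    rw [henter, hleave]

end IsJumpTimes

theorem bddAbove_jumpLength (hf : ∀ i, Continuous (f i)) (x y : ℝ≥0) (ℓ k : Fin m) :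
    BddAbove {v | ∃ T, IsJumpTimes x y ℓ k T ∧ v = jumpLength f ℓ k T} := by
  choose C hC using fun i =>
    (isCompact_Icc (a := x) (b := y)).exists_bound_of_continuousOn (hf i).continuousOn
  refine ⟨∑ i ∈ Finset.Icc k ℓ, (C i + C i), ?_⟩
  rintro _ ⟨T, hT, rfl⟩
  refine Finset.sum_le_sum fun i hi => ?_
  rw [Finset.mem_Icc, Fin.le_def, Fin.le_def] at hi
  have hmem : ∀ n : ℕ, k ≤ n → n ≤ ℓ + 1 → T n ∈ Icc x y := fun n h₁ h₂ => by
    rw [← hT.start, ← hT.finish]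
    exact ⟨hT.antitone h₂, hT.antitone h₁⟩
  have h₁ := abs_le.1 (hC i _ (hmem i hi.1 (by omega)))
  have h₂ := abs_le.1 (hC i _ (hmem (i + 1) (by omega) (by omega)))
  linarith [h₁.2, h₂.1]

theorem isJumpTimes_ite (hxy : x ≤ y) (hkℓ : k ≤ ℓ) :
    IsJumpTimes x y ℓ k fun n => if n ≤ k then y else x := by
  refine ⟨fun a b hab => ?_, if_neg (by rw [Fin.le_def] at hkℓ; omega), if_pos le_rfl⟩
  split_ifs <;> first | exact le_rfl | exact hxy | omega

/-- The last passage value is the supremum of the lengths over all jump times. -/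
theorem isLUB_lastPassage (hf : ∀ i, Continuous (f i)) (hxy : x ≤ y) (hkℓ : k ≤ ℓ) :
    IsLUB {v | ∃ T, IsJumpTimes x y ℓ k T ∧ v = jumpLength f ℓ k T} (lastPassage f x y ℓ k) := by
  rcases hxy.eq_or_lt with rfl | hlt
  · have : {v | ∃ T, IsJumpTimes x x ℓ k T ∧ v = jumpLength f ℓ k T} = {0} := by
      have hzero : ∀ T, IsJumpTimes x x ℓ k T → jumpLength f ℓ k T = 0 := fun T hT => by
        refine Finset.sum_eq_zero fun i hi => ?_
        rw [Finset.mem_Icc, Fin.le_def, Fin.le_def] at hi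
        have : T i = T (i + 1) := by
          refine le_antisymm ?_ (hT.antitone (Nat.le_succ _))
          calc T i ≤ T k := hT.antitone hi.1
            _ = T (ℓ + 1) := hT.finish.trans hT.start.symm
            _ ≤ T (i + 1) := hT.antitone (by omega)
        rw [this, sub_self]
      ext v
      constructor
      · rintro ⟨T, hT, rfl⟩
        exact hzero T hT
      · rintro rfl
        exact ⟨_, isJumpTimes_ite le_rfl hkℓ, (hzero _ (isJumpTimes_ite le_rfl hkℓ)).symm⟩
    rw [this, lastPassage, if_neg (lt_irrefl x)]
    exact isLUB_singleton
  · have : {L | ∃ π, IsLPPPath x y ℓ k π ∧ L = pathLength f x y ℓ k π} =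
        {v | ∃ T, IsJumpTimes x y ℓ k T ∧ v = jumpLength f ℓ k T} := by
      ext v
      constructor
      · rintro ⟨π, hπ, rfl⟩
        exact hπ.exists_jumpTimes hxy
      · rintro ⟨T, hT, rfl⟩
        obtain ⟨π, hπ, h⟩ := hT.exists_path (f := f) hlt hkℓ
        exact ⟨π, hπ, h.symm⟩
    rw [lastPassage, if_pos hlt, this]
    exact isLUB_csSup ⟨_, _, isJumpTimes_ite hxy hkℓ, rfl⟩ (bddAbove_jumpLength hf x y ℓ k)

end JumpTimes

/-! ### The recursion over the lines -/

/-- The values that the height of line `k` at time `y` competes with, when its height at time `x`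
is `a`: it follows `f k` from `x` on, or it is pushed up by the line `k + 1` at some time `s`. -/
def pushSet {m : ℕ} (f : Fin m → ℝ≥0 → ℝ) (H : ℝ≥0 → Fin m → ℝ) (a : ℝ) (x y : ℝ≥0) (k : Fin m) :
    Set ℝ :=
  {v | v = a + (f k y - f k x) ∨
    ∃ (j : Fin m) (s : ℝ≥0), (j : ℕ) = k + 1 ∧ x ≤ s ∧ s ≤ y ∧ v = H s j + (f k y - f k s)}

theorem jumpLength_self {m : ℕ} (f : Fin m → ℝ≥0 → ℝ) (k : Fin m) (T : ℕ → ℝ≥0) :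
    jumpLength f k k T = f k (T k) - f k (T (k + 1)) := by
  simp [jumpLength]

theorem jumpLength_succ {m : ℕ} (f : Fin m → ℝ≥0 → ℝ) {ℓ k j : Fin m} (hj : (j : ℕ) = k + 1)
    (hjℓ : j ≤ ℓ) (T : ℕ → ℝ≥0) :
    jumpLength f ℓ k T = jumpLength f ℓ j T + (f k (T k) - f k (T j)) := by
  have : Finset.Icc k ℓ = insert k (Finset.Icc j ℓ) := by
    ext i
    simp only [Finset.mem_insert, Finset.mem_Icc, Fin.le_def, Fin.ext_iff] at hjℓ ⊢
    omega
  rw [jumpLength, this, Finset.sum_insert, add_comm, hj, jumpLength]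
  rw [Finset.mem_Icc, Fin.le_def]
  omega

section Recursion

variable {m : ℕ} {Ω : Type*} {g : Fin m → ℝ} {B : Fin m → ℝ≥0 → Ω → ℝ} {ω : Ω}

theorem isLUB_brownianTASEP (hB : ∀ i, Continuous fun t => B i t ω) (y : ℝ≥0) (k : Fin m) :
    IsLUB {v | ∃ ℓ, k ≤ ℓ ∧ ∃ T, IsJumpTimes 0 y ℓ k T ∧
      v = g ℓ + jumpLength (fun i t => B i t ω) ℓ k T} (brownianTASEP g B y ω k) := by
  have hlp := fun ℓ (hℓ : k ≤ ℓ) =>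
    isLUB_lastPassage (f := fun i t => B i t ω) hB (zero_le (a := y)) hℓ
  constructor
  · rintro _ ⟨ℓ, hℓ, T, hT, rfl⟩
    calc g ℓ + jumpLength (fun i t => B i t ω) ℓ k T
        ≤ g ℓ + lastPassage (fun i t => B i t ω) 0 y ℓ k :=
          add_le_add_right ((hlp ℓ hℓ).1 ⟨T, hT, rfl⟩) _
      _ ≤ _ := Finset.le_sup' (fun ℓ => g ℓ + lastPassage (fun i t => B i t ω) 0 y ℓ k)
          (Finset.mem_Ici.2 hℓ)
  · intro c hc
    refine Finset.sup'_le _ _ fun ℓ hℓ => ?_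
    have hℓ := Finset.mem_Ici.1 hℓ
    rw [← le_sub_iff_add_le']
    refine (hlp ℓ hℓ).2 ?_
    rintro _ ⟨T, hT, rfl⟩
    rw [le_sub_iff_add_le']
    exact hc ⟨ℓ, hℓ, T, hT, rfl⟩

/-- Decompose at the entry time `s = T (k + 1)` into line `k`: the part before `s` is a path to `(s,
k + 1)`, and conversely any such path extends along line `k` up to `y`. -/
theorem isLUB_pushSet_initial (hB : ∀ i, Continuous fun t => B i t ω) (y : ℝ≥0) (k : Fin m) :
    IsLUB (pushSet (fun i t => B i t ω) (fun s => brownianTASEP g B s ω) (g k) 0 y k)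
      (brownianTASEP g B y ω k) := by
  constructor
  · rintro _ (rfl | ⟨j, s, hj, -, hsy, rfl⟩)
    · refine (isLUB_brownianTASEP hB y k).1
        ⟨k, le_rfl, _, isJumpTimes_ite zero_le le_rfl, ?_⟩
      simp [jumpLength_self]
    · rw [← le_sub_iff_add_le]
      refine (isLUB_brownianTASEP hB s j).2 ?_
      rintro _ ⟨ℓ, hjℓ, T, hT, rfl⟩
      have hjℓ' := Fin.le_def.1 hjℓ
      have hkℓ : k ≤ ℓ := Fin.le_def.2 (by omega)
      -- Only the entries up to index `k` change; `T j = s` becomes the time of the jump to line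
      -- `k`.
      have hT' : IsJumpTimes 0 y ℓ k fun n => if n ≤ k then y else T n := by
        refine ⟨fun a b hab => ?_, ?_, if_pos le_rfl⟩
        · split_ifs with h₁ h₂ h₂
          · exact le_rfl
          · omega
          · exact (hT.antitone (by omega : (j : ℕ) ≤ b)).trans (hT.finish.trans_le hsy)
          · exact hT.antitone hab
        · rw [if_neg (by omega), hT.start]
      rw [le_sub_iff_add_le]
      refine (isLUB_brownianTASEP hB y k).1 ⟨ℓ, hkℓ, _, hT', ?_⟩
      rw [jumpLength_succ _ hj hjℓ, if_pos le_rfl, if_neg (by omega), hT.finish, add_assoc]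
      congr 2
      refine Finset.sum_congr rfl fun i hi => ?_
      rw [Finset.mem_Icc, Fin.le_def] at hi
      have h₁ : ¬ (i : ℕ) ≤ k := by omega
      have h₂ : ¬ (i : ℕ) + 1 ≤ k := by omega
      simp only [h₁, h₂, if_false]
  · intro c hc
    refine (isLUB_brownianTASEP hB y k).2 ?_
    rintro _ ⟨ℓ, hkℓ, T, hT, rfl⟩
    rcases hkℓ.eq_or_lt with rfl | hlt
    · rw [jumpLength_self, hT.start, hT.finish]
      exact hc (Or.inl rfl)
    · have hlt' := Fin.lt_def.1 hlt
      let j : Fin m := ⟨k + 1, by omega⟩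
      have hjℓ : j ≤ ℓ := Fin.le_def.2 hlt'
      have hjy : T j ≤ y := by
        rw [← hT.finish]
        exact hT.antitone (Nat.le_succ _)
      rw [jumpLength_succ _ (j := j) rfl hjℓ, ← add_assoc]
      refine (add_le_add_left ((isLUB_brownianTASEP hB (T j) j).1
        ⟨ℓ, hjℓ, T, ⟨hT.antitone, hT.start, rfl⟩, rfl⟩) _).trans (hc (Or.inr ?_))
      exact ⟨j, T j, rfl, zero_le, hjy, by rw [hT.finish]⟩

/-- The flow property: after time `x`, the heights are determined by the heights at time `x` and
the increments of the lines after time `x`. -/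
theorem isLUB_pushSet (hB : ∀ i, Continuous fun t => B i t ω) {x y : ℝ≥0} (hxy : x ≤ y)
    (k : Fin m) :
    IsLUB (pushSet (fun i t => B i t ω) (fun s => brownianTASEP g B s ω)
      (brownianTASEP g B x ω k) x y k) (brownianTASEP g B y ω k) := by
  have hy := isLUB_pushSet_initial (g := g) hB y k
  have hx := isLUB_pushSet_initial (g := g) hB x k
  constructor
  · rintro _ (rfl | ⟨j, s, hj, -, hsy, rfl⟩)
    · rw [← le_sub_iff_add_le]
      refine hx.2 ?_
      rintro _ (rfl | ⟨j, s, hj, -, hsx, rfl⟩) <;> rw [le_sub_iff_add_le]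
      · exact hy.1 (Or.inl (by ring))
      · exact hy.1 (Or.inr ⟨j, s, hj, zero_le, hsx.trans hxy, by ring⟩)
    · exact hy.1 (Or.inr ⟨j, s, hj, zero_le, hsy, rfl⟩)
  · intro c hc
    have hc₀ := hc (Or.inl rfl)
    refine hy.2 ?_
    rintro _ (rfl | ⟨j, s, hj, -, hsy, rfl⟩)
    · linarith [hx.1 (Or.inl rfl)]
    -- A push at `s ≤ x` already counts in the height at `x`, which then follows line `k`.
    · rcases le_total x s with hxs | hsx
      · exact hc (Or.inr ⟨j, s, hj, hxs, hsy, rfl⟩)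
      · linarith [hx.1 (Or.inr ⟨j, s, hj, zero_le, hsx, rfl⟩)]

/-- The running supremum of a continuous function is continuous. -/
theorem continuous_sSup_image_mul {φ : ℝ≥0 → ℝ} (hφ : Continuous φ) :
    Continuous fun y => sSup ((fun t => φ (t * y)) '' Icc (0 : ℝ≥0) 1) :=
  isCompact_Icc.continuous_sSup (f := fun y t => φ (t * y)) (by fun_prop)

/-- The substitution `s = t * y` replaces the moving interval `[0, y]` by the fixed compact `[0,
1]`. -/
theorem isLUB_sSup_image_mul {φ : ℝ≥0 → ℝ} (hφ : Continuous φ) (y : ℝ≥0) :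
    IsLUB (φ '' Iic y) (sSup ((fun t => φ (t * y)) '' Icc (0 : ℝ≥0) 1)) := by
  have : φ '' Iic y = (fun t => φ (t * y)) '' Icc (0 : ℝ≥0) 1 := by
    ext v
    constructor
    · rintro ⟨s, hs, rfl⟩
      rcases eq_or_ne y 0 with rfl | hy
      · exact ⟨0, by simp, by simp [le_antisymm (mem_Iic.1 hs) zero_le]⟩
      · exact ⟨s / y, ⟨zero_le, div_le_one_of_le₀ hs zero_le⟩, by
          simp only [div_mul_cancel₀ s hy]⟩
    · rintro ⟨t, ht, rfl⟩
      exact ⟨t * y, mul_le_of_le_one_left zero_le ht.2, rfl⟩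
  rw [this]
  exact (isCompact_Icc.image (by fun_prop)).isLUB_sSup ((nonempty_Icc.2 zero_le_one).image _)

/-- Downward induction: `H_k - B_k` is the maximum of a constant and the running supremum of
`H_{k+1} - B_k`. -/
theorem continuous_brownianTASEP_apply (hB : ∀ i, Continuous fun t => B i t ω) (k : Fin m) :
    Continuous fun y => brownianTASEP g B y ω k := by
  induction k using WellFoundedGT.induction with
  | ind k ih =>
  by_cases hk : (k : ℕ) + 1 < m
  · let j : Fin m := ⟨k + 1, hk⟩
    have hj : Continuous fun s => brownianTASEP g B s ω j :=
      ih j (Fin.lt_def.2 (Nat.lt_succ_self _))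
    have hφ : Continuous fun s => brownianTASEP g B s ω j - B k s ω := hj.sub (hB k)
    have : (fun y => brownianTASEP g B y ω k) = fun y => B k y ω + max (g k - B k 0 ω)
        (sSup ((fun t => brownianTASEP g B (t * y) ω j - B k (t * y) ω) '' Icc (0 : ℝ≥0) 1)) := by
      funext y
      have hsup := isLUB_sSup_image_mul hφ y
      refine (isLUB_pushSet_initial hB y k).unique ⟨?_, fun c hc => ?_⟩
      · rintro _ (rfl | ⟨i, s, hi, -, hsy, rfl⟩)
        · linarith [le_max_left (g k - B k 0 ω) (sSup ((fun t =>
            brownianTASEP g B (t * y) ω j - B k (t * y) ω) '' Icc (0 : ℝ≥0) 1))]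
        · obtain rfl : i = j := Fin.ext hi
          linarith [(hsup.1 ⟨s, hsy, rfl⟩).trans (le_max_right (g k - B k 0 ω) _)]
      · rw [← le_sub_iff_add_le']
        refine max_le ?_ (hsup.2 ?_)
        · linarith [hc (Or.inl rfl)]
        · rintro _ ⟨s, hs, rfl⟩
          linarith [hc (Or.inr ⟨j, s, rfl, zero_le, hs, rfl⟩)]
    rw [this]
    exact (hB k).add (continuous_const.max (continuous_sSup_image_mul hφ))
  · have : (fun y => brownianTASEP g B y ω k) = fun y => g k + (B k y ω - B k 0 ω) := by
      funext y
      refine (isLUB_pushSet_initial hB y k).unique ⟨?_, fun c hc => hc (Or.inl rfl)⟩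
      rintro _ (rfl | ⟨i, s, hi, -⟩)
      · exact le_rfl
      · exact absurd i.2 (by omega)
    rw [this]
    exact continuous_const.add ((hB k).sub continuous_const)

/-- Heights in `[x, y]` are measurable functions of the heights at time `x` and the increments
of the lines on `[x, y]`. -/
theorem measurable_brownianTASEP_apply {𝓐 : MeasurableSpace Ω}
    (hB : ∀ i ω, Continuous fun t => B i t ω) {x y : ℝ≥0}
    (hx : ∀ k, Measurable[𝓐] fun ω => brownianTASEP g B x ω k)
    (hinc : ∀ i t, x ≤ t → t ≤ y → Measurable[𝓐] fun ω => B i t ω - B i x ω)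
    (k : Fin m) {t : ℝ≥0} (hxt : x ≤ t) (hty : t ≤ y) :
    Measurable[𝓐] fun ω => brownianTASEP g B t ω k := by
  induction k using WellFoundedGT.induction generalizing t with
  | ind k ih =>
  have : Nonempty (Icc x t) := ⟨⟨x, left_mem_Icc.2 hxt⟩⟩
  let d := TopologicalSpace.denseSeq (Icc x t)
  refine measurable_of_Iic fun c => ?_
  -- By continuity in `s`, a dense sequence of push times suffices. Increments are written relative
  -- to time `x`, the only form assumed measurable.
  have hset : (fun ω => brownianTASEP g B t ω k) ⁻¹' Iic c =
      {ω | brownianTASEP g B x ω k + (B k t ω - B k x ω) ≤ c} ∩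
        ⋂ j : {j : Fin m // (j : ℕ) = k + 1}, ⋂ n, {ω | brownianTASEP g B (d n) ω j +
          ((B k t ω - B k x ω) - (B k (d n) ω - B k x ω)) ≤ c} := by
    ext ω
    rw [mem_preimage, mem_Iic,
      isLUB_le_iff (isLUB_pushSet (g := g) (fun i => hB i ω) hxt k)]
    simp only [mem_inter_iff, mem_iInter, mem_ofPred_eq, sub_sub_sub_cancel_right]
    refine ⟨fun h => ⟨h (Or.inl rfl), fun j n => h (Or.inr
      ⟨j, d n, j.2, (d n).2.1, (d n).2.2, rfl⟩)⟩, ?_⟩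
    rintro ⟨h₀, h⟩ _ (rfl | ⟨j, s, hj, hxs, hst, rfl⟩)
    · exact h₀
    · have hcl : IsClosed {u : Icc x t | brownianTASEP g B u ω j + (B k t ω - B k u ω) ≤ c} :=
        isClosed_le (((continuous_brownianTASEP_apply (fun i => hB i ω) j).comp
          continuous_subtype_val).add (continuous_const.sub
            ((hB k ω).comp continuous_subtype_val))) continuous_const
      have hsub : range d ⊆ {u : Icc x t | brownianTASEP g B u ω j + (B k t ω - B k u ω) ≤ c} := by
        rintro _ ⟨n, rfl⟩
        exact h ⟨j, hj⟩ n
      exact hcl.closure_subset_iff.2 hsub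
        (TopologicalSpace.denseRange_denseSeq (Icc x t) ⟨s, hxs, hst⟩)
  rw [hset]
  refine MeasurableSet.inter (measurableSet_le ((hx k).add (hinc k t hxt hty)) measurable_const)
    (MeasurableSet.iInter fun j => MeasurableSet.iInter fun n => measurableSet_le ?_
      measurable_const)
  have hjk : k < j := Fin.lt_def.2 (by rw [j.2]; exact Nat.lt_succ_self _)
  exact (ih j hjk (d n).2.1 ((d n).2.2.trans hty)).add
    ((hinc k t hxt hty).sub (hinc k (d n) (d n).2.1 ((d n).2.2.trans hty)))

theorem brownianTASEP_zero (ω : Ω) (k : Fin m) :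
    brownianTASEP g B 0 ω k = (Finset.Ici k).sup' ⟨k, Finset.mem_Ici.2 le_rfl⟩ g := by
  simp [brownianTASEP, lastPassage]

end Recursion

/-! ### Measurability and conditional expectations -/

/-- A random continuous function on a compact space is Borel measurable if its values are. -/
theorem ContinuousMap.measurable_borel_of_eval {Ω K : Type*} [MeasurableSpace Ω]
    [TopologicalSpace K] [CompactSpace K] [T2Space K]
    [SecondCountableTopology K] {X : Ω → C(K, ℝ)}
    (hX : ∀ u, Measurable fun ω => X ω u) : Measurable[_, borel C(K, ℝ)] X := by
  let _ : MeasurableSpace C(K, ℝ) := borel _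
  have : BorelSpace C(K, ℝ) := ⟨rfl⟩
  rcases isEmpty_or_nonempty K with hK | hK
  · have : Subsingleton C(K, ℝ) := ⟨fun a b => ContinuousMap.ext fun u => hK.elim u⟩
    exact measurable_of_subsingleton_codomain X
  have hdist : ∀ φ : C(K, ℝ), Measurable fun ω => dist (X ω) φ := fun φ => by
    refine measurable_of_Iic fun c => ?_
    have : (fun ω => dist (X ω) φ) ⁻¹' Iic c =
        ⋂ n, {ω | dist (X ω (TopologicalSpace.denseSeq K n))
          (φ (TopologicalSpace.denseSeq K n)) ≤ c} := by
      ext ω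
      simp only [mem_preimage, mem_Iic, ContinuousMap.dist_le_iff_of_nonempty, mem_iInter,
        mem_ofPred_eq]
      refine ⟨fun h n => h _, fun h u => ?_⟩
      have hcl : IsClosed {u | dist (X ω u) (φ u) ≤ c} :=
        isClosed_le ((X ω).continuous.dist φ.continuous) continuous_const
      have hsub : Set.range (TopologicalSpace.denseSeq K) ⊆ {u | dist (X ω u) (φ u) ≤ c} := by
        rintro _ ⟨n, rfl⟩
        exact h n
      exact hcl.closure_subset_iff.2 hsub (TopologicalSpace.denseRange_denseSeq K u)
    rw [this]
    exact MeasurableSet.iInter fun n =>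
      measurableSet_le ((hX _).dist measurable_const) measurable_const
  have hbasis : TopologicalSpace.IsTopologicalBasis
      {s : Set C(K, ℝ) | ∃ φ r, s = Metric.ball φ r} := by
    refine TopologicalSpace.isTopologicalBasis_of_isOpen_of_nhds ?_ fun φ u hφ hu => ?_
    · rintro _ ⟨φ, r, rfl⟩
      exact Metric.isOpen_ball
    · obtain ⟨r, hr, h⟩ := Metric.isOpen_iff.1 hu φ hφ
      exact ⟨_, ⟨φ, r, rfl⟩, Metric.mem_ball_self hr, h⟩
  -- Since `C(K, ℝ)` is second countable, balls generate its Borel sets.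
  have hgen := hbasis.borel_eq_generateFrom
  change Measurable[_, borel C(K, ℝ)] X
  rw [hgen]
  refine measurable_generateFrom ?_
  rintro _ ⟨φ, r, rfl⟩
  exact hdist φ measurableSet_Iio

theorem measurable_pi_borel_of_eval {Ω ι K : Type*} [Countable ι] [MeasurableSpace Ω]
    [TopologicalSpace K] [CompactSpace K] [T2Space K]
    [SecondCountableTopology K] {X : Ω → ι → C(K, ℝ)}
    (hX : ∀ i u, Measurable fun ω => X ω i u) : Measurable[_, borel (ι → C(K, ℝ))] X := by
  let _ : MeasurableSpace C(K, ℝ) := borel _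
  have : BorelSpace C(K, ℝ) := ⟨rfl⟩
  rw [← BorelSpace.measurable_eq (α := ι → C(K, ℝ))]
  exact measurable_pi_iff.2 fun i => ContinuousMap.measurable_borel_of_eval (hX i)

theorem measurable_borel_eval {ι K : Type*} [TopologicalSpace K] [CompactSpace K] (i : ι) (u : K) :
    Measurable[borel (ι → C(K, ℝ))] fun φ : ι → C(K, ℝ) => φ i u := by
  let _ : MeasurableSpace (ι → C(K, ℝ)) := borel _
  have : BorelSpace (ι → C(K, ℝ)) := ⟨rfl⟩
  exact Continuous.measurable (by fun_prop)

section CondExp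

variable {Ω : Type*} {mΩ : MeasurableSpace Ω} {P : Measure Ω} [IsProbabilityMeasure P]
  {𝓕 𝓖 𝓗 : MeasurableSpace Ω}

/-- The product formula for an integrable function and an independent event. -/
theorem setIntegral_eq_mul_of_indep (h𝓗 : 𝓗 ≤ mΩ) (h𝓕 : 𝓕 ≤ mΩ) (hind : Indep 𝓗 𝓕 P)
    {φ : Ω → ℝ} (hφ : StronglyMeasurable[𝓗] φ) (hφi : Integrable φ P) {t : Set Ω}
    (ht : MeasurableSet[𝓕] t) : ∫ ω in t, φ ω ∂P = P.real t * ∫ ω, φ ω ∂P := by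
  rw [← setIntegral_condExp h𝓕 hφi ht,
    setIntegral_congr_ae (g := fun _ => ∫ ω, φ ω ∂P) (h𝓕 _ ht)
      ((condExp_indep_eq h𝓗 h𝓕 hφ hind).mono fun ω h _ => h), setIntegral_const, smul_eq_mul]

/-- The conditional probability given `𝓗` of an event in `𝓖 ≥ 𝓗` is also its conditional
probability given `𝓗 ⊔ 𝓕`, for `𝓕` independent of `𝓖`. -/
theorem setIntegral_condExp_of_indep_sup (h𝓗𝓖 : 𝓗 ≤ 𝓖) (h𝓖 : 𝓖 ≤ mΩ) (h𝓕 : 𝓕 ≤ mΩ)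
    (hind : Indep 𝓖 𝓕 P) {G : Set Ω} (hG : MeasurableSet[𝓖] G) {t : Set Ω}
    (ht : MeasurableSet[𝓗 ⊔ 𝓕] t) : ∫ ω in t, (P⟦G | 𝓗⟧) ω ∂P = P.real (t ∩ G) := by
  have hsup : 𝓗 ⊔ 𝓕 ≤ mΩ := sup_le (h𝓗𝓖.trans h𝓖) h𝓕
  have hGi : Integrable (G.indicator fun _ => (1 : ℝ)) P :=
    (integrable_const 1).indicator (h𝓖 _ hG)
  have hset : ∀ A, MeasurableSet[𝓗] A → ∫ ω in A, (P⟦G | 𝓗⟧) ω ∂P = P.real (A ∩ G) := by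
    intro A hA
    rw [setIntegral_condExp (h𝓗𝓖.trans h𝓖) hGi hA, setIntegral_indicator (h𝓖 _ hG),
      setIntegral_const, smul_eq_mul, mul_one]
  have hgen : 𝓗 ⊔ 𝓕 = MeasurableSpace.generateFrom
      {s | ∃ A B, MeasurableSet[𝓗] A ∧ MeasurableSet[𝓕] B ∧ s = A ∩ B} := by
    refine le_antisymm (sup_le (fun A hA => ?_) fun B hB => ?_)
      (MeasurableSpace.generateFrom_le ?_)
    · exact MeasurableSpace.measurableSet_generateFrom
        ⟨A, univ, hA, MeasurableSet.univ, (inter_univ A).symm⟩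
    · exact MeasurableSpace.measurableSet_generateFrom
        ⟨univ, B, MeasurableSet.univ, hB, (univ_inter B).symm⟩
    · rintro _ ⟨A, B, hA, hB, rfl⟩
      exact MeasurableSet.inter (le_sup_left (a := 𝓗) (b := 𝓕) _ hA)
        (le_sup_right (a := 𝓗) (b := 𝓕) _ hB)
  have hpi : IsPiSystem {s : Set Ω | ∃ A B, MeasurableSet[𝓗] A ∧ MeasurableSet[𝓕] B ∧
      s = A ∩ B} := by
    rintro _ ⟨A, B, hA, hB, rfl⟩ _ ⟨A', B', hA', hB', rfl⟩ _
    exact ⟨A ∩ A', B ∩ B', hA.inter hA', hB.inter hB', by ac_rfl⟩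
  -- Dynkin's π-λ argument over the sets `A ∩ B`. On such a set, independence gives `P(B) P(A ∩ G) =
  -- P(A ∩ B ∩ G)`, as `A ∩ G` lies in `𝓖`.
  refine MeasurableSpace.induction_on_inter (C := fun t _ =>
    ∫ ω in t, (P⟦G | 𝓗⟧) ω ∂P = P.real (t ∩ G)) hgen hpi ?_ ?_ ?_ ?_ t ht
  · simp
  · rintro _ ⟨A, B, hA, hB, rfl⟩
    have hA' := (h𝓗𝓖.trans h𝓖) _ hA
    rw [inter_comm A B, ← setIntegral_indicator hA',
      setIntegral_eq_mul_of_indep (h𝓗𝓖.trans h𝓖) h𝓕 (indep_of_indep_of_le_left hind h𝓗𝓖)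
        (stronglyMeasurable_condExp.indicator hA) (integrable_condExp.indicator hA') hB,
      integral_indicator hA', hset A hA, inter_assoc, inter_comm B]
    have := (Indep_iff 𝓖 𝓕 P).1 hind (A ∩ G) B ((h𝓗𝓖 _ hA).inter hG) hB
    rw [measureReal_def P (A ∩ G ∩ B), this, ENNReal.toReal_mul, mul_comm]
    rfl
  · intro t ht h
    have ht' := hsup _ ht
    have h₁ := integral_add_compl ht' (integrable_condExp (μ := P) (m := 𝓗)
      (f := G.indicator fun _ => (1 : ℝ)))
    have h₂ := hset univ MeasurableSet.univ
    rw [setIntegral_univ, univ_inter] at h₂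
    have h₃ := measureReal_inter_add_sdiff (μ := P) (s := G) ht'
    rw [inter_comm G t, sdiff_eq, inter_comm G tᶜ] at h₃
    linarith
  · intro s hdisj hs h
    have hs' : ∀ n, MeasurableSet[mΩ] (s n) := fun n => hsup _ (hs n)
    rw [integral_iUnion hs' hdisj integrable_condExp.integrableOn, iUnion_inter,
      measureReal_def, measure_iUnion, ENNReal.tsum_toReal_eq fun n => measure_ne_top P _]
    · exact tsum_congr h
    · exact fun i j hij => (hdisj hij).mono inter_subset_left inter_subset_left
    · exact fun n => (hs' n).inter (h𝓖 _ hG)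

/-- Conditional expectation is self-adjoint: both sides equal the integral of the product of the two
conditional probabilities. -/
theorem setIntegral_condExp_comm (h𝓗 : 𝓗 ≤ mΩ) {s t : Set Ω} (hs : MeasurableSet[mΩ] s)
    (ht : MeasurableSet[mΩ] t) : ∫ ω in s, (P⟦t | 𝓗⟧) ω ∂P = ∫ ω in t, (P⟦s | 𝓗⟧) ω ∂P := by
  have key : ∀ {s t : Set Ω}, MeasurableSet[mΩ] s → MeasurableSet[mΩ] t →
      ∫ ω in s, (P⟦t | 𝓗⟧) ω ∂P = ∫ ω, (P⟦t | 𝓗⟧) ω * (P⟦s | 𝓗⟧) ω ∂P := by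
    intro s t hs ht
    have hsi : Integrable (s.indicator fun _ => (1 : ℝ)) P := (integrable_const 1).indicator hs
    have hmul : (P⟦t | 𝓗⟧) * s.indicator (fun _ => (1 : ℝ)) = s.indicator (P⟦t | 𝓗⟧) := by
      ext ω
      by_cases h : ω ∈ s <;> simp [h]
    have hpull := condExp_mul_of_stronglyMeasurable_left (μ := P) (m := 𝓗)
      (f := P⟦t | 𝓗⟧) (g := s.indicator fun _ => (1 : ℝ)) stronglyMeasurable_condExp
      (by rw [hmul]; exact integrable_condExp.indicator hs) hsi
    rw [← integral_indicator hs, ← hmul, ← integral_condExp h𝓗, integral_congr_ae hpull]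
    rfl
  rw [key hs ht, key ht hs]
  simp only [mul_comm]

/-- If `𝓗 ≤ 𝓖` and `𝓕` is independent of `𝓖`, the conditional probabilities of an event in
`𝓗 ⊔ 𝓕` given `𝓖` and given `𝓗` coincide. -/
theorem condExp_eq_of_indep_sup (h𝓗𝓖 : 𝓗 ≤ 𝓖) (h𝓖 : 𝓖 ≤ mΩ) (h𝓕 : 𝓕 ≤ mΩ)
    (hind : Indep 𝓖 𝓕 P) {E : Set Ω} (hE : MeasurableSet[𝓗 ⊔ 𝓕] E) :
    P⟦E | 𝓖⟧ =ᵐ[P] P⟦E | 𝓗⟧ := by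
  have hE' : MeasurableSet[mΩ] E := sup_le (h𝓗𝓖.trans h𝓖) h𝓕 _ hE
  refine (ae_eq_condExp_of_forall_setIntegral_eq h𝓖 ((integrable_const (1 : ℝ)).indicator hE')
    (fun _ _ _ => integrable_condExp.integrableOn) (fun G hG _ => ?_)
    (stronglyMeasurable_condExp.mono h𝓗𝓖).aestronglyMeasurable).symm
  -- Self-adjointness moves the conditioning from `E` to `G`, where independence applies.
  rw [setIntegral_condExp_comm (h𝓗𝓖.trans h𝓖) (h𝓖 _ hG) hE',
    setIntegral_condExp_of_indep_sup h𝓗𝓖 h𝓖 h𝓕 hind hG hE, setIntegral_indicator hE',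
    setIntegral_const, smul_eq_mul, mul_one, inter_comm]

end CondExp

/-! ### Independence of the past and the future increments -/

theorem iIndepFun_bool {Ω : Type*} {mΩ : MeasurableSpace Ω} {P : Measure Ω}
    [IsProbabilityMeasure P] {β : Type*} [MeasurableSpace β] {X : Bool → Ω → β}
    (h : IndepFun (X true) (X false) P) : iIndepFun X P := by
  rw [iIndepFun_iff_iIndep, iIndep_iff]
  intro S s hs
  have hS : ∀ S : Finset Bool, S = ∅ ∨ S = {true} ∨ S = {false} ∨ S = {true, false} := by decide
  rcases hS S with rfl | rfl | rfl | rfl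
  · simp
  · simp
  · simp
  · have h' := (Indep_iff _ _ P).1 ((IndepFun_iff_Indep (X true) (X false) P).1 h) (s true)
      (s false) (hs true (by simp)) (hs false (by simp))
    rw [Finset.prod_pair (by decide), ← h', Finset.set_biInter_insert, Finset.set_biInter_singleton]

section Independence

variable {Ω : Type*} {mΩ : MeasurableSpace Ω} {P : Measure Ω} {m : ℕ}
  {B : Fin m → ℝ≥0 → Ω → ℝ}

namespace IsRateTwoBrownianEnsemble

/-- Truncating time at `x` gives past and future the same path space, so that `Bool` can index them
as one family. -/
theorem indepFun_shift (hB : IsRateTwoBrownianEnsemble B P) (x : ℝ≥0) (i : Fin m) :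
    IndepFun (fun ω t => B i (min t x) ω) (fun ω t => B i (x + t) ω - B i x ω) P := by
  have h := ((hB.brownian i).toIsPreBrownianReal.indepFun_shift x).symm.comp
    (φ := fun (p : Iic x → ℝ) (t : ℝ≥0) => p ⟨min t x, min_le_right t x⟩ * √2)
    (ψ := fun (q : ℝ≥0 → ℝ) (t : ℝ≥0) => q t * √2)
    (by fun_prop) (by fun_prop)
  have h2 : (√2 : ℝ) ≠ 0 := by positivity
  convert h using 3
  · simp [div_mul_cancel₀ _ h2]
  · simp [sub_mul, div_mul_cancel₀ _ h2]

/-- Independence across lines, combined with independence of past and future within each line, makes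
the family indexed by pairs (line, past or future) independent; it is then regrouped. -/
theorem indepFun_past_future [IsProbabilityMeasure P] (hB : IsRateTwoBrownianEnsemble B P) (x : ℝ≥0) :
    IndepFun (fun ω i t => B i (min t x) ω) (fun ω i t => B i (x + t) ω - B i x ω) P := by
  let X : Fin m → Bool → Ω → ℝ≥0 → ℝ := fun i b ω t =>
    if b then B i (min t x) ω else B i (x + t) ω - B i x ω
  have hmeas := hB.measurable
  have hX : ∀ i b, Measurable (X i b) := by
    rintro i (_ | _)
    · exact measurable_pi_iff.2 fun t => (hmeas i (x + t)).sub (hmeas i x)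
    · exact measurable_pi_iff.2 fun t => hmeas i (min t x)
  have h₁ : iIndepFun (fun i ω => (X i · ω)) P := by
    refine hB.indep.comp (fun _ (p : ℝ≥0 → ℝ) (b : Bool) (t : ℝ≥0) =>
      if b then p (min t x) else p (x + t) - p x) fun _ => ?_
    refine measurable_pi_iff.2 ?_
    rintro (_ | _)
    · exact measurable_pi_iff.2 fun t => (measurable_pi_apply _).sub (measurable_pi_apply _)
    · exact measurable_pi_iff.2 fun t => measurable_pi_apply _
  have h₂ : ∀ i, iIndepFun (X i) P := fun i => iIndepFun_bool (hB.indepFun_shift x i)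
  have h := (iIndepFun_uncurry' hX h₁ h₂).indepFun_finset
    (Finset.univ ×ˢ {true}) (Finset.univ ×ˢ {false}) (by simp [Finset.disjoint_left])
    fun p => hX p.1 p.2
  exact h.comp (φ := fun p i => p ⟨(i, true), by simp⟩) (ψ := fun p i => p ⟨(i, false), by simp⟩)
    (measurable_pi_iff.2 fun i => measurable_pi_apply _)
    (measurable_pi_iff.2 fun i => measurable_pi_apply _)

end IsRateTwoBrownianEnsemble

end Independence

/-! ### The Markov property of Brownian TASEP -/

theorem measurable_pi_of_apply {Ω ι : Type*} {𝓐 : MeasurableSpace Ω} {X : Ω → ι → ℝ}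
    (h : ∀ k, Measurable[𝓐] fun ω => X ω k) : Measurable[𝓐] X :=
  measurable_pi_iff.2 h

theorem measurable_pi_of_apply₂ {Ω ι κ : Type*} {𝓐 : MeasurableSpace Ω} {X : Ω → ι → κ → ℝ}
    (h : ∀ i t, Measurable[𝓐] fun ω => X ω i t) : Measurable[𝓐] X :=
  measurable_pi_iff.2 fun i => measurable_pi_of_apply (h i)

theorem measurable_comap_apply {Ω ι : Type*} (X : Ω → ι → ℝ) (k : ι) :
    Measurable[MeasurableSpace.comap X inferInstance] fun ω => X ω k :=
  fun _ hs => ⟨_, measurable_pi_apply k hs, rfl⟩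

theorem measurable_comap_apply₂ {Ω ι κ : Type*} (X : Ω → ι → κ → ℝ) (i : ι) (t : κ) :
    Measurable[MeasurableSpace.comap X inferInstance] fun ω => X ω i t :=
  fun _ hs => ⟨_, measurable_pi_apply i (measurable_pi_apply t hs), rfl⟩

section Markov

variable {Ω : Type*} {mΩ : MeasurableSpace Ω} {P : Measure Ω} [IsProbabilityMeasure P]
  {m : ℕ} {g : Fin m → ℝ} {B : Fin m → ℝ≥0 → Ω → ℝ}

/-- Given any σ-algebra between `σ(H x)` and the past of the driving motions at time `x`, the
probability of an event that depends on `H x` and the future increments is its conditional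
probability given `H x`. -/
theorem IsRateTwoBrownianEnsemble.condExp_brownianTASEP_eq (hB : IsRateTwoBrownianEnsemble B P)
    {x : ℝ≥0} {𝓖 : MeasurableSpace Ω}
    (h𝓗 : MeasurableSpace.comap (brownianTASEP g B x) inferInstance ≤ 𝓖)
    (h𝓖 : ∀ 𝓐 : MeasurableSpace Ω, (∀ k u, u ≤ x →
      Measurable[𝓐] fun ω => brownianTASEP g B u ω k) → 𝓖 ≤ 𝓐)
    {E : Set Ω} (hE : ∀ 𝓐 : MeasurableSpace Ω, (∀ k u, x ≤ u →
      Measurable[𝓐] fun ω => brownianTASEP g B u ω k) → MeasurableSet[𝓐] E) :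
    P⟦E | 𝓖⟧ =ᵐ[P] P⟦E | MeasurableSpace.comap (brownianTASEP g B x) inferInstance⟧ := by
  let past : Ω → Fin m → ℝ≥0 → ℝ := fun ω i t => B i (min t x) ω
  let future : Ω → Fin m → ℝ≥0 → ℝ := fun ω i t => B i (x + t) ω - B i x ω
  have hpast_meas : Measurable[mΩ] past := measurable_pi_of_apply₂ fun i t =>
    hB.measurable i _
  have hfuture_meas : Measurable[mΩ] future := measurable_pi_of_apply₂ fun i t =>
    (hB.measurable i _).sub (hB.measurable i _)
  have hind := (IndepFun_iff_Indep _ _ P).1 (hB.indepFun_past_future x)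
  let mPast : MeasurableSpace Ω := MeasurableSpace.comap past inferInstance
  let 𝓕 : MeasurableSpace Ω := MeasurableSpace.comap future inferInstance
  have hpast : ∀ i u, u ≤ x → Measurable[mPast] (B i u) := fun i u hu => by
    have h := measurable_comap_apply₂ past i u
    simpa only [past, min_eq_left hu] using h
  have hfuture : ∀ i u, x ≤ u → Measurable[𝓕] fun ω => B i u ω - B i x ω := fun i u hu => by
    have h := measurable_comap_apply₂ future i (u - x)
    simpa only [future, add_tsub_cancel_of_le hu] using h
  -- By `h𝓖` it is enough that the past of `B` makes all heights up to `x` measurable; they are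
  -- built from the deterministic `H(0)` and increments before `x`.
  have h𝓖_le : 𝓖 ≤ mPast := by
    refine h𝓖 mPast fun k u hu => measurable_brownianTASEP_apply hB.continuous (x := 0) (y := x)
      (fun k => ?_) (fun i t _ ht => (hpast i t ht).sub (hpast i 0 zero_le)) k zero_le hu
    simp only [brownianTASEP_zero]
    exact measurable_const
  let mSup : MeasurableSpace Ω :=
    MeasurableSpace.comap (brownianTASEP g B x) inferInstance ⊔ 𝓕
  have h𝓗_le : MeasurableSpace.comap (brownianTASEP g B x) inferInstance ≤ mSup := le_sup_left
  have h𝓕_le : 𝓕 ≤ mSup := le_sup_right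
  have hsup : ∀ k u, x ≤ u → Measurable[mSup] fun ω => brownianTASEP g B u ω k := fun k u hu =>
    measurable_brownianTASEP_apply (𝓐 := mSup) hB.continuous (y := u)
      (fun k => (measurable_comap_apply (brownianTASEP g B x) k).mono h𝓗_le le_rfl)
      (fun i t ht _ => (hfuture i t ht).mono h𝓕_le le_rfl) k hu le_rfl
  exact condExp_eq_of_indep_sup h𝓗 (h𝓖_le.trans hpast_meas.comap_le) hfuture_meas.comap_le
    (indep_of_indep_of_le_left hind h𝓖_le) (hE _ hsup)

end Markov

theorem mainTheorem7 {Ω : Type*} {mΩ : MeasurableSpace Ω} (P : Measure Ω) [IsProbabilityMeasure P]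
    (m : ℕ) (hm : 1 ≤ m) (g : Fin m → ℝ) (hg : Antitone g)
    (B : Fin m → ℝ≥0 → Ω → ℝ) (hB : IsRateTwoBrownianEnsemble B P) :
    ∃ (hcont : ∀ ω, Continuous fun t => brownianTASEP g B t ω)
      (hmeas : ∀ t, StronglyMeasurable (brownianTASEP g B t)),
      (∀ x y : ℝ≥0, Measurable[mΩ, borel (PathSpace m x y)]
        (restrictPath (brownianTASEP g B) hcont x y)) ∧
      (∀ x y : ℝ≥0, x ≤ y → ∀ A : Set (PathSpace m x y),
        MeasurableSet[borel (PathSpace m x y)] A →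
        P⟦restrictPath (brownianTASEP g B) hcont x y ⁻¹' A |
            MeasurableSpace.comap (restrictPath (brownianTASEP g B) hcont 0 x)
              (borel (PathSpace m 0 x))⟧
          =ᵐ[P]
        P⟦restrictPath (brownianTASEP g B) hcont x y ⁻¹' A |
            MeasurableSpace.comap (brownianTASEP g B x) inferInstance⟧) ∧
      IsMarkovProcess (Filtration.natural (brownianTASEP g B) hmeas) (brownianTASEP g B) P := by
  have hcont : ∀ ω, Continuous fun t => brownianTASEP g B t ω := fun ω =>
    continuous_pi fun k => continuous_brownianTASEP_apply (fun i => hB.continuous i ω) k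
  have hmeas' : ∀ k t, Measurable fun ω => brownianTASEP g B t ω k := fun k t =>
    measurable_brownianTASEP_apply hB.continuous (x := 0) (y := t)
      (fun k => by simp only [brownianTASEP_zero]; exact measurable_const)
      (fun i u _ _ => (hB.measurable i u).sub (hB.measurable i 0)) k zero_le le_rfl
  have hmeas : ∀ t, StronglyMeasurable (brownianTASEP g B t) := fun t =>
    (measurable_pi_iff.2 fun k => hmeas' k t).stronglyMeasurable
  refine ⟨hcont, hmeas, fun x y => measurable_pi_borel_of_eval fun k u => hmeas' k u, ?_, ?_, ?_⟩
  · intro x y hxy A hA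
    refine hB.condExp_brownianTASEP_eq ?_ (fun 𝓐 h𝓐 => ?_) fun 𝓐 h𝓐 => ?_
    -- `H(x)` is the value of the path on `[0, x]` at its right endpoint.
    · refine Measurable.comap_le (measurable_pi_of_apply fun k s hs => ?_)
      exact ⟨_, measurable_borel_eval k ⟨x, zero_le, le_rfl⟩ hs, rfl⟩
    · exact Measurable.comap_le (measurable_pi_borel_of_eval fun k u => h𝓐 k u u.2.2)
    · exact measurable_pi_borel_of_eval (X := restrictPath (brownianTASEP g B) hcont x y)
        (fun k u => h𝓐 k u u.2.1) hA
  · exact fun t => (Filtration.stronglyAdapted_natural hmeas t).measurable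
  · intro s t hst A hA
    refine hB.condExp_brownianTASEP_eq ?_ (fun 𝓐 h𝓐 => ?_) fun 𝓐 h𝓐 => ?_
    · exact le_iSup₂_of_le s le_rfl le_rfl
    · exact iSup₂_le fun u hu => Measurable.comap_le (measurable_pi_iff.2 fun k => h𝓐 k u hu)
    · exact measurable_pi_iff.2 (fun k => h𝓐 k t hst) hA
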